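/- For a positive integer $n$ and a set $S\subseteq\mathbb{Z}_n\setminus\{0\}$ with $S=-S$, let $G(\mathbb{Z}_n,S)$ be the circulant graph with vertex set $\mathbb{Z}_n$ in which $i$ and $j$ are adjacent if and only if $j-i\in S$. The spectrum of a finite graph is the multiset of eigenvalues of its adjacency matrix, counted with multiplicity. Two graphs are cospectral if their spectra are equal, and singularly cospectral if the multisets of absolute values of their nonzero eigenvalues, counted with multiplicity, are equal. Let $n,k,s$ be integers with $n=2k$, $k\ge 6$ and $2\le s\le k-3$. Then the circulant graphs $G_1=G(\mathbb{Z}_n,\{\pm1,\ldots,\pm s\})$ and $G_2=G(\mathbb{Z}_n,\{k\pm1,\ldots,k\pm s\})$ are singularly cospectral but not cospectral. -/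

import Mathlib

namespace NCSC

open scoped Classical in
/-- The spectrum of a finite graph: the multiset of the eigenvalues of its adjacency matrix, i.e. of
the roots of the characteristic polynomial, counted with multiplicity. -/
noncomputable def graphSpectrum {V : Type*} [Fintype V] (G : SimpleGraph V) : Multiset ℝ :=
  (G.adjMatrix ℝ).charpoly.roots

/-- Two finite graphs are cospectral if they have the same spectrum. -/
def Cospectral {V W : Type*} [Fintype V] [Fintype W] (G : SimpleGraph V) (H : SimpleGraph W) :
    Prop :=
  graphSpectrum G = graphSpectrum H

/-- Two finite graphs are singularly cospectral if the absolute values of their nonzero eigenvalues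
coincide, counted with multiplicity. -/
def SingularlyCospectral {V W : Type*} [Fintype V] [Fintype W] (G : SimpleGraph V)
    (H : SimpleGraph W) : Prop :=
  ((graphSpectrum G).filter (· ≠ 0)).map (fun x => |x|) =
    ((graphSpectrum H).filter (· ≠ 0)).map (fun x => |x|)

/-- Noncospectral singularly cospectral pairs of graphs. -/
def IsNCSC {V W : Type*} [Fintype V] [Fintype W] (G : SimpleGraph V) (H : SimpleGraph W) : Prop :=
  SingularlyCospectral G H ∧ ¬ Cospectral G H

/-- The subset `{c ± 1, …, c ± s}` of `ℤ / n`. -/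
def jumps (n : ℕ) (c : ZMod n) (s : ℕ) : Set (ZMod n) :=
  {x | ∃ h : ℕ, 1 ≤ h ∧ h ≤ s ∧ (x = c + (h : ZMod n) ∨ x = c - (h : ZMod n))}

end NCSC

namespace NCSC

open Matrix

/-! ### Spectra of symmetric circulant matrices. -/

section Spectrum

/-! Let `A`, `B` be the adjacency matrices and `P` the permutation matrix of translation by `k`.
Then `B = P * A`, where `P` commutes with `A` and `P ^ 2 = 1`. So `A ^ 2 = B ^ 2`, and the squared
eigenvalues agree (`circulant_shift_sq`, `roots_charpoly_pow`).

Cospectrality would force `tr A³ = tr B³`. Up to the factor `2k`, `tr A³ - tr B³` counts triples in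
`{±1, …, ±s}` with sum `0` minus those with sum `k`. For `2s < k` a direct count gives a positive
number (`sum_sum_pos`). Otherwise `(A - B)³ = 4(A³ - B³)` shows that the trace difference depends
only on `A - B`, which is unchanged under `s ↦ k - 1 - s`; this reduces to the first case
(`trace_cube_ne`). -/

theorem isHermitian_circulant_indicator {V : Type*} [AddGroup V] {S : Set V} (hS : ∀ x ∈ S, -x ∈ S) :
    (circulant (S.indicator (fun _ => (1 : ℝ)))).IsHermitian := by
  have hiff : ∀ x, -x ∈ S ↔ x ∈ S := fun x => ⟨fun h => by simpa using hS _ h, hS x⟩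
  classical
  ext i j
  rw [conjTranspose_apply, circulant_apply, circulant_apply, Set.indicator_apply,
    Set.indicator_apply, ← neg_sub j i, star_trivial]
  simp only [hiff]

variable {V : Type*} [Fintype V] [DecidableEq V]

theorem roots_charpoly_pow {A : Matrix V V ℝ} (hA : A.IsHermitian) (m : ℕ) :
    (A ^ m).charpoly.roots = A.charpoly.roots.map (· ^ m) := by
  have hpow : A ^ m = Unitary.conjStarAlgAut ℝ _ hA.eigenvectorUnitary
      (diagonal (fun i => hA.eigenvalues i ^ m)) := by
    conv_lhs => rw [hA.spectral_theorem, ← map_pow, diagonal_pow]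
    rfl
  have hchar : (A ^ m).charpoly =
      ∏ i, (Polynomial.X - Polynomial.C (hA.eigenvalues i ^ m)) := by
    rw [hpow, Unitary.conjStarAlgAut_apply, charpoly_mul_comm, ← mul_assoc]
    simp [charpoly_diagonal]
  rw [hchar, Polynomial.roots_prod _ _
    (Finset.prod_ne_zero_iff.2 fun i _ => Polynomial.X_sub_C_ne_zero _),
    hA.roots_charpoly_eq_eigenvalues, Multiset.map_map]
  simp only [Polynomial.roots_X_sub_C, Multiset.bind_singleton]
  rfl

/-- Since `|x| = √(x²)`, singular cospectrality follows once the multisets of squared eigenvalues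
agree. -/
theorem map_abs_filter_ne_zero (M : Multiset ℝ) :
    (M.filter (· ≠ 0)).map (fun x => |x|) =
      ((M.map (· ^ 2)).map Real.sqrt).filter (· ≠ 0) := by
  rw [Multiset.map_map, Multiset.filter_map]
  simp [Function.comp_def, Real.sqrt_sq_eq_abs]

theorem trace_pow_eq_sum_roots {A : Matrix V V ℝ} (hA : A.IsHermitian) (m : ℕ) :
    (A ^ m).trace = (A.charpoly.roots.map (· ^ m)).sum := by
  rw [trace_eq_sum_roots_charpoly_of_splits (hA.pow m).splits_charpoly, roots_charpoly_pow hA]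

theorem graphSpectrum_circulantGraph [AddGroup V] {S : Set V} (hS : ∀ x ∈ S, -x ∈ S)
    (h0 : (0 : V) ∉ S) :
    graphSpectrum (SimpleGraph.circulantGraph S) =
      (circulant (S.indicator (fun _ => (1 : ℝ)))).charpoly.roots := by
  classical
  have hadj : (SimpleGraph.circulantGraph S).adjMatrix ℝ =
      circulant (S.indicator (fun _ => (1 : ℝ))) := by
    ext u v
    rw [SimpleGraph.adjMatrix_apply, circulant_apply, Set.indicator_apply]
    congr 1
    rw [SimpleGraph.circulantGraph_adj, eq_iff_iff]
    constructor
    · rintro ⟨-, h | h⟩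
      · exact h
      · simpa using hS _ h
    · intro h
      refine ⟨?_, Or.inl h⟩
      rintro rfl
      exact h0 (by simpa using h)
  unfold graphSpectrum
  rw [← hadj]
  congr!

end Spectrum

/-! ### Translation by an element of order dividing two, and traces of cubes. -/

section Trace

variable {V : Type*} [Fintype V] [DecidableEq V] [AddCommGroup V]

theorem circulant_single_mul (c : V) (f : V → ℝ) :
    circulant (Pi.single c 1) * circulant f = circulant (fun x => f (x - c)) := by
  ext i j
  rw [mul_apply, circulant_apply, Finset.sum_eq_single (i - c)]
  · simp [circulant_apply, sub_right_comm]
  · intro l _ hl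
    have : i - l ≠ c := fun h => hl (by rw [← h]; abel)
    simp [circulant_apply, this]
  · simp

theorem circulant_single_mul_self {c : V} (hc : c + c = 0) :
    circulant (Pi.single c (1 : ℝ)) * circulant (Pi.single c 1) = 1 := by
  rw [circulant_single_mul, ← circulant_single_one]
  congr 1
  ext x
  simp [Pi.single_apply, sub_eq_iff_eq_add, hc]

theorem circulant_shift_sq {c : V} (hc : c + c = 0) (f : V → ℝ) :
    circulant (fun x => f (x - c)) ^ 2 = circulant f ^ 2 := by
  have hcomm : Commute (circulant (Pi.single c (1 : ℝ))) (circulant f) :=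
    circulant_mul_comm _ _
  rw [← circulant_single_mul, hcomm.mul_pow, pow_two (circulant (Pi.single c (1 : ℝ))),
    circulant_single_mul_self hc, one_mul]

/-- From `P ^ 2 = 1`, `1 - P` is twice an idempotent, so `(1 - P)³ = 4(1 - P)`, while `P³ = P`. -/
theorem circulant_sub_shift_cube {c : V} (hc : c + c = 0) (f : V → ℝ) :
    circulant (fun x => f x - f (x - c)) ^ 3 =
      4 • (circulant f ^ 3 - circulant (fun x => f (x - c)) ^ 3) := by
  have hcomm : Commute (circulant (Pi.single c (1 : ℝ))) (circulant f) :=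
    circulant_mul_comm _ _
  have hP := circulant_single_mul_self hc
  have hsub : circulant (fun x => f x - f (x - c)) =
      (1 - circulant (Pi.single c (1 : ℝ))) * circulant f := by
    rw [sub_mul, one_mul, circulant_single_mul]
    rfl
  rw [hsub, ← circulant_single_mul, hcomm.mul_pow,
    ((Commute.one_left _).sub_left hcomm).mul_pow]
  generalize circulant (Pi.single c (1 : ℝ)) = P at hP
  have hP3 : P ^ 3 = P := by rw [pow_succ, pow_two, hP, one_mul]
  have hone : (1 - P) ^ 3 = 4 • (1 - P) := by
    have : (1 - P) ^ 3 = 1 - 3 • P + 3 • (P * P) - P ^ 3 := by noncomm_ring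
    rw [this, hP, hP3]
    noncomm_ring
  rw [hone, hP3, smul_mul_assoc, sub_mul, one_mul]

theorem trace_circulant_cube (f : V → ℝ) :
    (circulant f ^ 3).trace =
      Fintype.card V * ∑ a, ∑ b, f a * f b * f (-(a + b)) := by
  have hdiag : ∀ i, (circulant f ^ 3) i i = ∑ a, ∑ b, f a * f b * f (-(a + b)) := by
    intro i
    rw [pow_succ', pow_two, mul_apply, ← Equiv.sum_comp (Equiv.subLeft i)]
    refine Finset.sum_congr rfl fun a _ => ?_
    rw [mul_apply, Finset.mul_sum, ← Equiv.sum_comp (Equiv.subLeft (i - a))]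
    refine Finset.sum_congr rfl fun b _ => ?_
    simp only [circulant_apply, Equiv.subLeft_apply, mul_assoc]
    congr 3 <;> abel
  simp [trace, hdiag]

theorem trace_circulant_cube_sub_shift {c : V} (hc : c + c = 0) (f : V → ℝ) :
    (circulant f ^ 3).trace - (circulant (fun x => f (x - c)) ^ 3).trace =
      Fintype.card V * ∑ a, f a * ∑ b, f b * (f (-(a + b)) - f (-(a + b) - c)) := by
  -- Translating both `a` and `b` by `c` leaves `a + b` fixed, so only the third factor keeps its
  -- shift.
  have hshift : ∑ a, ∑ b, f (a - c) * f (b - c) * f (-(a + b) - c) =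
      ∑ a, ∑ b, f a * f b * f (-(a + b) - c) := by
    rw [← Equiv.sum_comp (Equiv.addRight c)]
    refine Finset.sum_congr rfl fun a _ => ?_
    rw [← Equiv.sum_comp (Equiv.addRight c)]
    refine Finset.sum_congr rfl fun b _ => ?_
    have : a + c + (b + c) = a + b := by rw [add_add_add_comm, hc, add_zero]
    simp [this]
  rw [trace_circulant_cube, trace_circulant_cube, hshift, ← mul_sub, ← Finset.sum_sub_distrib]
  congr 1
  refine Finset.sum_congr rfl fun a _ => ?_
  rw [← Finset.sum_sub_distrib, Finset.mul_sum]
  refine Finset.sum_congr rfl fun b _ => ?_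
  ring

end Trace

/-! ### Membership in the connection sets through integer representatives. -/

section Jumps

theorem neg_mem_jumps_zero {n s : ℕ} {x : ZMod n} (hx : x ∈ jumps n 0 s) : -x ∈ jumps n 0 s := by
  obtain ⟨h, h1, h2, rfl | rfl⟩ := hx
  · exact ⟨h, h1, h2, Or.inr (by ring)⟩
  · exact ⟨h, h1, h2, Or.inl (by ring)⟩

theorem mem_jumps_iff_sub_mem {n s : ℕ} {c x : ZMod n} :
    x ∈ jumps n c s ↔ x - c ∈ jumps n 0 s := by
  simp only [jumps, Set.mem_ofPred_eq, zero_add, zero_sub, sub_eq_iff_eq_add, neg_add_eq_sub,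
    add_comm c]

variable {k s : ℕ}

theorem half_add_half (k : ℕ) : ((k : ZMod (2 * k)) + k) = 0 := by
  have := ZMod.natCast_self (2 * k)
  push_cast at this
  rw [← two_mul, this]

theorem intCast_mem_jumps_zero (hsk : s < k) {m : ℤ} (hm : |m| ≤ k) :
    (m : ZMod (2 * k)) ∈ jumps (2 * k) 0 s ↔ 1 ≤ |m| ∧ |m| ≤ s := by
  have key : ∀ d : ℤ, |d| < k → ((m : ZMod (2 * k)) = (d : ZMod (2 * k))) → m = d := by
    intro d hd h
    rw [ZMod.intCast_eq_intCast_iff_dvd_sub] at h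
    have := Int.eq_zero_of_abs_lt_dvd h (by push_cast; grind)
    lia
  constructor
  · rintro ⟨h, h1, h2, hx | hx⟩
    · have := key h (by grind) (by simpa using hx)
      grind
    · have := key (-h) (by grind) (by simpa using hx)
      grind
  · rintro ⟨h1, h2⟩
    rcases le_total 0 m with h0 | h0
    · refine ⟨m.toNat, by grind, by grind, Or.inl ?_⟩
      rw [zero_add, ← Int.cast_natCast, Int.toNat_of_nonneg h0]
    · refine ⟨(-m).toNat, by grind, by grind, Or.inr ?_⟩
      rw [zero_sub, ← Int.cast_natCast, Int.toNat_of_nonneg (by lia)]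
      simp

/-- Modulo `2k`, subtracting `k` equals adding `k`; choosing the sign opposite to `m` stays in `[-k,
k]` and turns `|m|` into `k - |m|`. -/
theorem intCast_sub_half_mem_jumps_zero (hsk : s < k) {m : ℤ} (hm : |m| ≤ k) :
    (m : ZMod (2 * k)) - k ∈ jumps (2 * k) 0 s ↔ 1 ≤ k - |m| ∧ k - |m| ≤ s := by
  rcases le_total 0 m with h0 | h0
  · have h : (m : ZMod (2 * k)) - k = ((m - k : ℤ) : ZMod (2 * k)) := by push_cast; rfl
    rw [h, intCast_mem_jumps_zero hsk (by grind)]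
    grind
  · have h : (m : ZMod (2 * k)) - k = ((m + k : ℤ) : ZMod (2 * k)) := by
      push_cast
      rw [sub_eq_iff_eq_add, add_assoc, half_add_half, add_zero]
    rw [h, intCast_mem_jumps_zero hsk (by grind)]
    grind

theorem zero_notMem_jumps_zero (hsk : s < k) : (0 : ZMod (2 * k)) ∉ jumps (2 * k) 0 s := by
  intro h
  have := (intCast_mem_jumps_zero hsk (m := 0) (by simp)).1 (by rwa [Int.cast_zero])
  grind

theorem zero_notMem_jumps_half (hsk : s < k) : (0 : ZMod (2 * k)) ∉ jumps (2 * k) k s := by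
  intro h
  have := (intCast_sub_half_mem_jumps_zero hsk (m := 0) (by simp)).1
    (by rwa [Int.cast_zero, ← mem_jumps_iff_sub_mem])
  rw [abs_zero] at this
  omega

theorem neg_mem_jumps_half {x : ZMod (2 * k)} (hx : x ∈ jumps (2 * k) k s) :
    -x ∈ jumps (2 * k) k s := by
  rw [mem_jumps_iff_sub_mem] at hx ⊢
  have h : -x - (k : ZMod (2 * k)) = -(x - k) := by
    linear_combination -half_add_half k
  rw [h]
  exact neg_mem_jumps_zero hx

open scoped Classical in
/-- The differences of the two connection sets agree for `s` and for `k - 1 - s`. -/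
theorem indicator_sub_shift_eq (hsk : s < k) (x : ZMod (2 * k)) :
    (jumps (2 * k) 0 s).indicator (fun _ => (1 : ℝ)) x -
        (jumps (2 * k) 0 s).indicator (fun _ => (1 : ℝ)) (x - k) =
      (jumps (2 * k) 0 (k - 1 - s)).indicator (fun _ => (1 : ℝ)) x -
        (jumps (2 * k) 0 (k - 1 - s)).indicator (fun _ => (1 : ℝ)) (x - k) := by
  have : NeZero (2 * k) := ⟨by lia⟩
  obtain ⟨m, hm, rfl⟩ : ∃ m : ℤ, |m| ≤ k ∧ (m : ZMod (2 * k)) = x := by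
    refine ⟨x.valMinAbs, ?_, ZMod.coe_valMinAbs x⟩
    have := ZMod.natAbs_valMinAbs_le x
    rw [Int.abs_eq_natAbs]
    lia
  have ht : k - 1 - s < k := by lia
  simp only [Set.indicator_apply, intCast_mem_jumps_zero hsk hm, intCast_mem_jumps_zero ht hm,
    intCast_sub_half_mem_jumps_zero hsk hm, intCast_sub_half_mem_jumps_zero ht hm]
  have hcast : ((k - 1 - s : ℕ) : ℤ) = k - 1 - s := by lia
  rw [hcast]
  -- Both `[1, s] ∪ [s+1, k-1]` and `[1, k-1-s] ∪ [k-s, k-1]` partition `[1, k-1]`; rearranging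
  -- their indicators gives the identity.
  generalize |m| = a
  split_ifs <;> first | (exfalso; lia) | norm_num

theorem sum_indicator_jumps_mul [NeZero (2 * k)] (hsk : s < k) (F : ZMod (2 * k) → ℝ) :
    ∑ x, (jumps (2 * k) 0 s).indicator (fun _ => (1 : ℝ)) x * F x =
      ∑ h ∈ Finset.Icc 1 s, (F (h : ZMod (2 * k)) + F (-(h : ZMod (2 * k)))) := by
  classical
  have hinj : ∀ a b : ℤ, |a| < k → |b| < k → (a : ZMod (2 * k)) = b → a = b := by
    intro a b ha hb h
    rw [ZMod.intCast_eq_intCast_iff_dvd_sub] at h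
    have := Int.eq_zero_of_abs_lt_dvd h (by push_cast; grind)
    lia
  have hset : Finset.univ.filter (· ∈ jumps (2 * k) 0 s) =
      (Finset.Icc 1 s).image (fun h : ℕ => (h : ZMod (2 * k))) ∪
        (Finset.Icc 1 s).image (fun h : ℕ => -(h : ZMod (2 * k))) := by
    ext x
    simp only [jumps, Finset.mem_filter, Finset.mem_univ, true_and, Set.mem_ofPred_eq, zero_add,
      zero_sub, Finset.mem_union, Finset.mem_image, Finset.mem_Icc]
    grind
  have hdisj : Disjoint ((Finset.Icc 1 s).image (fun h : ℕ => (h : ZMod (2 * k))))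
      ((Finset.Icc 1 s).image (fun h : ℕ => -(h : ZMod (2 * k)))) := by
    rw [Finset.disjoint_left]
    simp only [Finset.mem_image, Finset.mem_Icc]
    rintro _ ⟨a, ha, rfl⟩ ⟨b, hb, h⟩
    have := hinj (-b) a (by grind) (by grind) (by simpa using h)
    lia
  simp only [Set.indicator_apply, ite_mul, one_mul, zero_mul]
  rw [← Finset.sum_filter, hset, Finset.sum_union hdisj, Finset.sum_image, Finset.sum_image,
    Finset.sum_add_distrib]
  · intro a ha b hb h
    simp only [Finset.coe_Icc, Set.mem_Icc] at ha hb
    have := hinj (-a) (-b) (by grind) (by grind) (by simpa using h)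
    lia
  · intro a ha b hb h
    simp only [Finset.coe_Icc, Set.mem_Icc] at ha hb
    have := hinj a b (by grind) (by grind) (by simpa using h)
    lia

end Jumps

/-! ### Counting triples with sum zero against triples with sum `k`. -/

section Count

variable {k s : ℕ}

open scoped Classical in
/-- The contribution of the four pairs `(± a, ± b)` to the number of zero-sum triples in
`{±1, …, ±s}` minus the number of triples with sum `k`. -/
theorem indicator_sum_four (hs : 2 * s < k) {a b : ℕ} (ha : a ∈ Finset.Icc 1 s)
    (hb : b ∈ Finset.Icc 1 s) (d : ZMod (2 * k) → ℝ)
    (hd : ∀ x, d x = (jumps (2 * k) 0 s).indicator (fun _ => (1 : ℝ)) (-x) -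
      (jumps (2 * k) 0 s).indicator (fun _ => (1 : ℝ)) (-x - k)) :
    (d (a + b) + d (a + -b)) + (d (-a + b) + d (-a + -b)) =
      2 * ((if a + b ≤ s then 1 else 0) + (if a = b then 0 else 1) -
        if k - s ≤ a + b then 1 else 0) := by
  have hsk : s < k := by lia
  rw [Finset.mem_Icc] at ha hb
  have hval : ∀ m : ℤ, |m| < k → d m = (if 1 ≤ |m| ∧ |m| ≤ s then 1 else 0) -
      if 1 ≤ k - |m| ∧ k - |m| ≤ s then 1 else 0 := by
    intro m hm
    have hm' : |-m| ≤ (k : ℤ) := by rw [abs_neg]; exact hm.le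
    rw [hd, Set.indicator_apply, Set.indicator_apply, ← Int.cast_neg]
    simp only [intCast_mem_jumps_zero hsk hm', intCast_sub_half_mem_jumps_zero hsk hm', abs_neg]
  have h1 := hval (a + b) (by grind)
  have h2 := hval (a + -b) (by grind)
  have h3 := hval (-a + b) (by grind)
  have h4 := hval (-a + -b) (by grind)
  push_cast at h1 h2 h3 h4
  have e1 : |(a : ℤ) + b| = a + b := abs_of_nonneg (by lia)
  have e4 : |-(a : ℤ) + -b| = a + b := by rw [abs_of_nonpos (by lia)]; ring
  have e3 : |-(a : ℤ) + b| = |(a : ℤ) + -b| := by rw [← abs_neg]; congr 1; ring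
  have e2 : |(a : ℤ) + -b| < s := by grind
  have e2' : |(a : ℤ) + -b| = 0 ↔ a = b := by rw [abs_eq_zero]; lia
  have e2'' := abs_nonneg ((a : ℤ) + -b)
  rw [h1, h2, h3, h4, e1, e4, e3]
  generalize |(a : ℤ) + -b| = c at *
  clear h1 h2 h3 h4 hval hd e1 e3 e4
  have c1 : (1 ≤ (a : ℤ) + b ∧ (a : ℤ) + b ≤ s) ↔ a + b ≤ s := by omega
  have c2 : (1 ≤ (k : ℤ) - (a + b) ∧ (k : ℤ) - (a + b) ≤ s) ↔ k - s ≤ a + b := by omega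
  have c3 : (1 ≤ c ∧ c ≤ s) ↔ ¬ a = b := by omega
  -- As `c < s` and `2s < k`, differences `±(a - b)` are too far from `k`; only the sums `±(a + b)`
  -- can contribute to the subtracted term.
  have c4 : ¬ (1 ≤ (k : ℤ) - c ∧ (k : ℤ) - c ≤ s) := by omega
  simp only [c1, c2, c3, if_neg c4, ite_not]
  ring

/-- Apart from the factor `2`, the sum is at least `2(s - 1) + s(δ - 1)`, where `δ = 0` exactly when
`k = 2s + 1`. In that case the bound is `s - 2`, positive because `6 ≤ k` forces `s ≥ 3`. -/
theorem sum_sum_pos (hs : 2 ≤ s) (hk : 6 ≤ k) (hsk : 2 * s < k) :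
    0 < ∑ a ∈ Finset.Icc 1 s, ∑ b ∈ Finset.Icc 1 s,
      ((2 : ℝ) * ((if a + b ≤ s then 1 else 0) + (if a = b then 0 else 1) -
        if k - s ≤ a + b then 1 else 0)) := by
  simp only [← Finset.mul_sum]
  refine mul_pos two_pos ?_
  obtain ⟨δ, hδ⟩ : ∃ δ : ℝ, δ = if 2 * s + 2 ≤ k then 1 else 0 := ⟨_, rfl⟩
  -- The summand is at least `-1` on the diagonal and `0` off it. The gain `2` is kept only in row
  -- `a = 1`, `b < s`; the antidiagonal `a + b = s + 1` gains `1` when `s + 1 < k - s`.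
  have hle : ∀ a ∈ Finset.Icc 1 s, ∀ b ∈ Finset.Icc 1 s,
      ((if a = 1 then 2 else 0) - (if b = s then (if a = 1 then 2 else 0) else 0) -
        (if a = b then 1 else 0) + if b = s + 1 - a then δ else 0 : ℝ) ≤
      (if a + b ≤ s then 1 else 0) + (if a = b then 0 else 1) -
        if k - s ≤ a + b then 1 else 0 := by
    intro a ha b hb
    rw [Finset.mem_Icc] at ha hb
    rw [hδ]
    split_ifs <;> first | (exfalso; lia) | norm_num
  refine lt_of_lt_of_le ?_
    (Finset.sum_le_sum fun a ha => Finset.sum_le_sum fun b hb => hle a ha b hb)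
  have hrow : ∀ a ∈ Finset.Icc 1 s, ∑ b ∈ Finset.Icc 1 s,
      ((if a = 1 then 2 else 0) - (if b = s then (if a = 1 then 2 else 0) else 0) -
        (if a = b then 1 else 0) + if b = s + 1 - a then δ else 0 : ℝ) =
      (if a = 1 then 2 * (s : ℝ) - 2 else 0) + (δ - 1) := by
    intro a ha
    have ha' := Finset.mem_Icc.1 ha
    have hs' : s ∈ Finset.Icc 1 s := Finset.mem_Icc.2 (by lia)
    have hr : s + 1 - a ∈ Finset.Icc 1 s := Finset.mem_Icc.2 (by lia)
    rw [Finset.sum_add_distrib, Finset.sum_sub_distrib, Finset.sum_sub_distrib,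
      Finset.sum_ite_eq', Finset.sum_ite_eq, Finset.sum_ite_eq', if_pos ha, if_pos hs', if_pos hr,
      Finset.sum_const, Nat.card_Icc, nsmul_eq_mul]
    split_ifs <;> push_cast <;> ring
  have h1 : 1 ∈ Finset.Icc 1 s := Finset.mem_Icc.2 (by lia)
  rw [Finset.sum_congr rfl hrow, Finset.sum_add_distrib, Finset.sum_ite_eq', if_pos h1,
    Finset.sum_const, Nat.card_Icc, nsmul_eq_mul, Nat.add_sub_cancel, hδ]
  split_ifs with h
  · have : (2 : ℝ) ≤ s := by exact_mod_cast hs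
    linarith
  · have : (3 : ℝ) ≤ s := by exact_mod_cast (by lia : 3 ≤ s)
    linarith

theorem trace_cube_sub_pos [NeZero (2 * k)] (hs : 2 ≤ s) (hk : 6 ≤ k) (hsk : 2 * s < k) :
    0 < (circulant ((jumps (2 * k) 0 s).indicator (fun _ => (1 : ℝ))) ^ 3).trace -
      (circulant (fun x => (jumps (2 * k) 0 s).indicator (fun _ => (1 : ℝ))
        (x - (k : ZMod (2 * k)))) ^ 3).trace := by
  have hlt : s < k := by lia
  rw [trace_circulant_cube_sub_shift (half_add_half k)]
  refine mul_pos (by exact_mod_cast Fintype.card_pos) ?_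
  obtain ⟨d, hd⟩ : ∃ d : ZMod (2 * k) → ℝ, ∀ x,
      d x = (jumps (2 * k) 0 s).indicator (fun _ => (1 : ℝ)) (-x) -
        (jumps (2 * k) 0 s).indicator (fun _ => (1 : ℝ)) (-x - k) := ⟨_, fun _ => rfl⟩
  simp only [← hd, sum_indicator_jumps_mul hlt, ← Finset.sum_add_distrib]
  rw [Finset.sum_congr rfl fun a ha => Finset.sum_congr rfl fun b hb =>
    indicator_sum_four hsk ha hb d hd]
  exact sum_sum_pos hs hk hsk

/-- The traces of the cubes differ for all `2 ≤ s ≤ k - 3`, by the symmetry `s ↦ k - 1 - s`. -/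
theorem trace_cube_ne [NeZero (2 * k)] (hs : 2 ≤ s) (hk : 6 ≤ k) (hsk : s ≤ k - 3) :
    (circulant ((jumps (2 * k) 0 s).indicator (fun _ => (1 : ℝ))) ^ 3).trace ≠
      (circulant (fun x => (jumps (2 * k) 0 s).indicator (fun _ => (1 : ℝ))
        (x - (k : ZMod (2 * k)))) ^ 3).trace := by
  rw [← sub_ne_zero]
  by_cases h : 2 * s < k
  · exact (trace_cube_sub_pos hs hk h).ne'
  -- Here `k ≤ 2s` gives `2(k - 1 - s) < k`, and `s ≤ k - 3` gives `2 ≤ k - 1 - s`.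
  · have hpos := trace_cube_sub_pos (s := k - 1 - s) (k := k) (by lia) hk (by lia)
    have h1 := congrArg trace (circulant_sub_shift_cube (half_add_half k)
      ((jumps (2 * k) 0 s).indicator (fun _ => (1 : ℝ))))
    have h2 := congrArg trace (circulant_sub_shift_cube (half_add_half k)
      ((jumps (2 * k) 0 (k - 1 - s)).indicator (fun _ => (1 : ℝ))))
    rw [funext (indicator_sub_shift_eq (s := s) (k := k) (by lia)), h2, trace_smul, trace_smul,
      trace_sub, trace_sub] at h1
    intro h0
    rw [h0, smul_zero, smul_eq_zero] at h1
    rcases h1 with h1 | h1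
    · norm_num at h1
    · exact hpos.ne' h1

end Count

end NCSC

theorem theorem4p4 (n k s : ℕ) [NeZero n] (hn : n = 2 * k) (hk : 6 ≤ k) (hs : 2 ≤ s)
    (hsk : s ≤ k - 3) :
    NCSC.IsNCSC (SimpleGraph.circulantGraph (NCSC.jumps n 0 s))
      (SimpleGraph.circulantGraph (NCSC.jumps n (k : ZMod n) s)) := by
  subst hn
  have hlt : s < k := by lia
  have hshift : (NCSC.jumps (2 * k) (k : ZMod (2 * k)) s).indicator (fun _ => (1 : ℝ)) =
      fun x => (NCSC.jumps (2 * k) 0 s).indicator (fun _ => (1 : ℝ)) (x - k) := by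
    classical
    funext x
    simp only [Set.indicator_apply]
    rw [NCSC.mem_jumps_iff_sub_mem]
  have hA := NCSC.isHermitian_circulant_indicator
    (fun x hx => NCSC.neg_mem_jumps_zero (n := 2 * k) (s := s) (x := x) hx)
  have hB := NCSC.isHermitian_circulant_indicator
    (fun x hx => NCSC.neg_mem_jumps_half (k := k) (s := s) (x := x) hx)
  have hSA := NCSC.graphSpectrum_circulantGraph
    (fun x hx => NCSC.neg_mem_jumps_zero (x := x) hx) (NCSC.zero_notMem_jumps_zero hlt)
  have hSB := NCSC.graphSpectrum_circulantGraph
    (fun x hx => NCSC.neg_mem_jumps_half (x := x) hx) (NCSC.zero_notMem_jumps_half hlt)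
  constructor
  · unfold NCSC.SingularlyCospectral
    rw [NCSC.map_abs_filter_ne_zero, NCSC.map_abs_filter_ne_zero, hSA, hSB,
      ← NCSC.roots_charpoly_pow hA, ← NCSC.roots_charpoly_pow hB, hshift,
      NCSC.circulant_shift_sq (NCSC.half_add_half k)]
  · intro h
    unfold NCSC.Cospectral at h
    rw [hSA, hSB] at h
    refine NCSC.trace_cube_ne hs hk hsk ?_
    rw [← hshift, NCSC.trace_pow_eq_sum_roots hA, NCSC.trace_pow_eq_sum_roots hB, h]
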